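/- Let $W$ be a finite Coxeter group with simple reflections $s_i$ and length function $\ell$. Fix $0<\theta\le 1$, put $q=\theta^{-1}$, $P_W(q)=\sum_{w\in W}q^{\ell(w)}$ and $\pi(w)=q^{\ell(w)}/P_W(q)$. Let $H$ be the Iwahori–Hecke algebra of $W$ over $\mathbb C$: it has basis $\{T_w\}_{w\in W}$, unit $T_1$, and $T_{s_i}T_w=T_{s_iw}$ if $\ell(s_iw)=\ell(w)+1$, $T_{s_i}T_w=(q-1)T_w+qT_{s_iw}$ if $\ell(s_iw)=\ell(w)-1$. Put $\tilde T_w=q^{-\ell(w)}T_w$. The algebra $H$ is isomorphic to a finite direct sum of matrix algebras $\bigoplus_{\lambda\in\hat W}M_{d_\lambda}(\mathbb C)$, $d_\lambda\ge 1$. For any such isomorphism let $\rho^\lambda:H\to M_{d_\lambda}(\mathbb C)$ be its components (the irreducible representations of $H$) and $\chi^\lambda_H=\operatorname{Tr}\rho^\lambda$ the irreducible characters. There is exactly one index $\mathbf 1\in\hat W$ with $d_{\mathbf 1}=1$ and $\chi_H^{\mathbf 1}(T_w)=q^{\ell(w)}$ for all $w\in W$. Let $\vec t:H\to\mathbb C$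 be the linear functional with $\vec t(T_1)=P_W(q)$ and $\vec t(T_w)=0$ for $w\ne 1$; there are unique constants $t_\lambda$ (the generic degrees) with $\vec t=\sum_{\lambda\in\hat W} t_\lambda\chi^\lambda_H$. **Proposition 4.8.** Let $K=(K(x,y))_{x,y\in W}$ be a Markov chain on $W$ (a matrix with nonnegative entries and row sums $1$) that is reversible with respect to $\pi$, i.e. $\pi(x)K(x,y)=\pi(y)K(y,x)$ for all $x,y$, and that is given by left multiplication by an element of $H$, also denoted by $K$, in the sense that $K\,\tilde T_x=\sum_{y\in W}K(x,y)\tilde T_y$ for all $x\in W$. For an integer $m\ge 0$ let $K_x^m(y)=K^m(x,y)$ be the law after $m$ steps of the chain started at $x$, and let $\|f\|_2^2=\sum_{y\in W}f(y)^2\pi(y)$. Then for all $m\ge 0$: (a) for every $x\in W$, $$\Big\|\frac{K_x^m}{\pi}-1\Big\|_2^2=q^{-2\ell(x)}\sum_{\lambda\ne\mathbf 1}t_\lambda\,\chi^\lambda_H\big(T_{x^{-1}}K^{2m}T_x\big);$$ (b) $$\sum_{x\in W}\pi(x)\Big\|\frac{K_x^m}{\pi}-1\Big\|_2^2=\sum_{\lambda\ne\mathbf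 1}d_\lambda\,\chi^\lambda_H\big(K^{2m}\big).$$ -/

import Mathlib

namespace CoxeterSystem

noncomputable section

section Exchange

variable {B W : Type*} [Group W] {M : CoxeterMatrix B} (cs : CoxeterSystem M W)

open Classical in
/-- The action of a simple reflection on pairs `(t, ε)`, used to prove the exchange condition. -/
def signPerm (i : B) : Equiv.Perm (W × ZMod 2) where
  toFun p := (cs.simple i * p.1 * cs.simple i, p.2 + if p.1 = cs.simple i then 1 else 0)
  invFun p := (cs.simple i * p.1 * cs.simple i, p.2 + if p.1 = cs.simple i then 1 else 0)
  left_inv := by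
    rintro ⟨t, e⟩
    have h : cs.simple i * t * cs.simple i = cs.simple i ↔ t = cs.simple i := by
      constructor
      · intro h
        have := congrArg (fun x => cs.simple i * x * cs.simple i) h
        simpa [mul_assoc] using this
      · rintro rfl; simp
    have h2 : (1 : ZMod 2) + 1 = 0 := by decide
    refine Prod.ext (by simp [mul_assoc]) ?_
    simp only [h]
    split_ifs <;> simp [add_assoc, h2]
  right_inv := by
    rintro ⟨t, e⟩
    have h : cs.simple i * t * cs.simple i = cs.simple i ↔ t = cs.simple i := by
      constructor
      · intro h
        have := congrArg (fun x => cs.simple i * x * cs.simple i) h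
        simpa [mul_assoc] using this
      · rintro rfl; simp
    have h2 : (1 : ZMod 2) + 1 = 0 := by decide
    refine Prod.ext (by simp [mul_assoc]) ?_
    simp only [h]
    split_ifs <;> simp [add_assoc, h2]

open Classical in
theorem signPerm_pow (i j : B) (n : ℕ) (t : W) (e : ZMod 2) :
    ((cs.signPerm i * cs.signPerm j) ^ n) (t, e) =
      ((cs.simple i * cs.simple j) ^ n * t * ((cs.simple i * cs.simple j) ^ n)⁻¹,
        e + ∑ k ∈ Finset.range (2 * n),
          if t = ((cs.simple i * cs.simple j)⁻¹) ^ k * cs.simple j then 1 else 0) := by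
  induction n with
  | zero => simp
  | succ n ih =>
    set r := cs.simple i * cs.simple j with hr
    have hrj : cs.simple j * r = r⁻¹ * cs.simple j := by simp [hr, mul_assoc]
    have hrjn : ∀ n : ℕ, cs.simple j * r ^ n = r⁻¹ ^ n * cs.simple j := by
      intro n
      induction n with
      | zero => simp
      | succ n ih => rw [pow_succ, ← mul_assoc, ih, mul_assoc, hrj, pow_succ, mul_assoc]
    have h1 : r ^ n * t * (r ^ n)⁻¹ = cs.simple j ↔ t = r⁻¹ ^ (2 * n) * cs.simple j := by
      rw [mul_inv_eq_iff_eq_mul, hrjn, two_mul, pow_add, mul_assoc, ← eq_inv_mul_iff_mul_eq,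
        inv_pow]
    have h2 : cs.simple j * (r ^ n * t * (r ^ n)⁻¹) * cs.simple j = cs.simple i ↔
        t = r⁻¹ ^ (2 * n + 1) * cs.simple j := by
      have e1 : cs.simple j * cs.simple i = r⁻¹ := by simp [hr]
      rw [← mul_left_inj (cs.simple j), ← mul_right_inj (cs.simple j)]
      have e2 : cs.simple j * (cs.simple j * (r ^ n * t * (r ^ n)⁻¹) * cs.simple j * cs.simple j)
          = r ^ n * t * (r ^ n)⁻¹ := by simp [mul_assoc]
      rw [e2, mul_inv_eq_iff_eq_mul, ← hr, hrj, mul_assoc, hrjn,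
        ← eq_inv_mul_iff_mul_eq (a := t), ← inv_pow, ← mul_assoc, ← mul_assoc]
      have : r⁻¹ ^ n * r⁻¹ * r⁻¹ ^ n = r⁻¹ ^ (2 * n + 1) := by
        rw [← pow_succ, ← pow_add]; congr 1; ring
      rw [this]
    rw [pow_succ', Equiv.Perm.mul_apply, ih, Equiv.Perm.mul_apply]
    simp only [signPerm, Equiv.coe_fn_mk]
    rw [show 2 * (n + 1) = 2 * n + 1 + 1 by ring, Finset.sum_range_succ, Finset.sum_range_succ]
    simp only [h1, h2]
    refine Prod.ext ?_ ?_
    · simp only [pow_succ', mul_inv_rev, hr, inv_simple, mul_assoc]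
    · simp only [add_assoc]

theorem signPerm_isLiftable : M.IsLiftable cs.signPerm := by
  classical
  intro i j
  ext1 ⟨t, e⟩
  rw [signPerm_pow]
  have hm := cs.simple_mul_simple_pow i j
  have hs : ∀ a : ZMod 2, a + a = 0 := by decide
  rw [two_mul, Finset.sum_range_add]
  simp [pow_add, hm, hs]

open Classical in
theorem lift_signPerm_wordProd (ω : List B) (t : W) (e : ZMod 2) :
    cs.lift ⟨cs.signPerm, cs.signPerm_isLiftable⟩ (cs.wordProd ω) (t, e) =
      (cs.wordProd ω * t * (cs.wordProd ω)⁻¹, e + ((cs.rightInvSeq ω).count t : ℕ)) := by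
  induction ω with
  | nil => simp
  | cons i ω ih =>
    rw [wordProd_cons, map_mul, Equiv.Perm.mul_apply, ih, lift_apply_simple]
    have h : cs.wordProd ω * t * (cs.wordProd ω)⁻¹ = cs.simple i ↔
        (cs.wordProd ω)⁻¹ * cs.simple i * cs.wordProd ω = t := by
      rw [mul_inv_eq_iff_eq_mul, eq_comm, mul_assoc, inv_mul_eq_iff_eq_mul]
    simp only [signPerm, Equiv.coe_fn_mk, rightInvSeq, List.count_cons, h, beq_iff_eq]
    refine Prod.ext ?_ ?_
    · simp [mul_assoc]
    · push_cast
      simp [add_assoc]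

/-- A right descent of `w` occurs in the right inversion sequence of every word for `w`. -/
theorem simple_mem_rightInvSeq (ω : List B) (i : B)
    (h : cs.IsRightDescent (cs.wordProd ω) i) : cs.simple i ∈ cs.rightInvSeq ω := by
  classical
  obtain ⟨ω', hω', hw⟩ := cs.exists_isReduced (cs.wordProd ω * cs.simple i)
  have hw' : cs.wordProd (ω'.concat i) = cs.wordProd ω := by
    rw [wordProd_concat, ← hw]; simp
  have hred : cs.IsReduced (ω'.concat i) := by
    have := cs.isRightDescent_iff.1 h
    rw [IsReduced, hw', List.length_concat, ← hω'.eq, ← hw]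
    exact this.symm
  have hmem : cs.simple i ∈ cs.rightInvSeq (ω'.concat i) := by
    rw [rightInvSeq_concat]; simp
  have hc := List.count_eq_one_of_mem hred.nodup_rightInvSeq hmem
  have e1 := cs.lift_signPerm_wordProd (ω'.concat i) (cs.simple i) 0
  have e2 := cs.lift_signPerm_wordProd ω (cs.simple i) 0
  rw [hw', e2, hc] at e1
  have e3 := congrArg Prod.snd e1
  by_contra hn
  rw [List.count_eq_zero_of_not_mem hn] at e3
  simp at e3

theorem simple_mul_eq_mul_simple_aux {w : W} {i j : B}
    (h1 : cs.length (cs.simple i * w) = cs.length w + 1)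
    (h2 : cs.length (w * cs.simple j) = cs.length w + 1)
    (h3 : cs.length (cs.simple i * w * cs.simple j) = cs.length w) :
    cs.simple i * w = w * cs.simple j := by
  obtain ⟨ω, hω, rfl⟩ := cs.exists_isReduced w
  have hd : cs.IsRightDescent (cs.wordProd (i :: ω)) j := by
    rw [IsRightDescent, wordProd_cons]; omega
  have hm := cs.simple_mem_rightInvSeq _ _ hd
  rw [rightInvSeq, List.mem_cons] at hm
  rcases hm with hm | hm
  · rw [hm]; simp [mul_assoc]
  · have := (cs.isRightInversion_of_mem_rightInvSeq hω hm).2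
    omega

theorem simple_mul_eq_mul_simple {w : W} {i j : B}
    (h1 : cs.length (cs.simple i * w) = cs.length (w * cs.simple j))
    (h2 : cs.length (cs.simple i * w * cs.simple j) = cs.length w) :
    cs.simple i * w = w * cs.simple j := by
  rcases cs.length_simple_mul w i with h | h
  · exact cs.simple_mul_eq_mul_simple_aux h (by omega) h2
  · have := cs.simple_mul_eq_mul_simple_aux (w := cs.simple i * w) (i := i) (j := j)
      (by simp; omega) (by omega) (by simp; omega)
    have h4 : w = cs.simple i * w * cs.simple j := by simpa using this
    conv_rhs => rw [h4]
    simp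

end Exchange

section Algebra

variable {B W : Type*} [Group W] {M : CoxeterMatrix B}

/-- The Iwahori-Hecke algebra of a Coxeter system with real parameter `q`: as a vector space, the
complex vector space with basis `W`. -/
def HeckeAlgebra (_cs : CoxeterSystem M W) (_q : ℝ) : Type _ := W →₀ ℂ

variable (cs : CoxeterSystem M W) (q : ℝ)

instance : AddCommGroup (cs.HeckeAlgebra q) := inferInstanceAs (AddCommGroup (W →₀ ℂ))

instance : Module ℂ (cs.HeckeAlgebra q) := inferInstanceAs (Module ℂ (W →₀ ℂ))

/-- The standard basis `T_w`, `w ∈ W`, of the Iwahori-Hecke algebra. -/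
def heckeBasis : Module.Basis W ℂ (cs.HeckeAlgebra q) :=
  Module.Basis.ofRepr (LinearEquiv.refl ℂ (W →₀ ℂ))

/-- The standard basis element `T_w` of the Iwahori-Hecke algebra. -/
def heckeT (w : W) : cs.HeckeAlgebra q := cs.heckeBasis q w

open Classical in
/-- The operator `T_w ↦ T_{sw}` if `ℓ(sw) > ℓ(w)`, and `T_w ↦ (q-1) T_w + q T_{sw}` otherwise. -/
def heckeLeft (s : W) : Module.End ℂ (cs.HeckeAlgebra q) :=
  (cs.heckeBasis q).constr ℂ fun w =>
    if cs.length w < cs.length (s * w) then cs.heckeT q (s * w)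
    else ((q : ℂ) - 1) • cs.heckeT q w + (q : ℂ) • cs.heckeT q (s * w)

open Classical in
/-- The operator `T_w ↦ T_{ws}` if `ℓ(ws) > ℓ(w)`, and `T_w ↦ (q-1) T_w + q T_{ws}` otherwise. -/
def heckeRight (s : W) : Module.End ℂ (cs.HeckeAlgebra q) :=
  (cs.heckeBasis q).constr ℂ fun w =>
    if cs.length w < cs.length (w * s) then cs.heckeT q (w * s)
    else ((q : ℂ) - 1) • cs.heckeT q w + (q : ℂ) • cs.heckeT q (w * s)

theorem heckeLeft_of_lt {s w : W} (h : cs.length w < cs.length (s * w)) :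
    cs.heckeLeft q s (cs.heckeT q w) = cs.heckeT q (s * w) := by
  simp [heckeLeft, heckeT, h]

theorem heckeLeft_of_not_lt {s w : W} (h : ¬ cs.length w < cs.length (s * w)) :
    cs.heckeLeft q s (cs.heckeT q w) =
      ((q : ℂ) - 1) • cs.heckeT q w + (q : ℂ) • cs.heckeT q (s * w) := by
  simp [heckeLeft, heckeT, h]

theorem heckeRight_of_lt {s w : W} (h : cs.length w < cs.length (w * s)) :
    cs.heckeRight q s (cs.heckeT q w) = cs.heckeT q (w * s) := by
  simp [heckeRight, heckeT, h]

theorem heckeRight_of_not_lt {s w : W} (h : ¬ cs.length w < cs.length (w * s)) :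
    cs.heckeRight q s (cs.heckeT q w) =
      ((q : ℂ) - 1) • cs.heckeT q w + (q : ℂ) • cs.heckeT q (w * s) := by
  simp [heckeRight, heckeT, h]

theorem commute_heckeLeft_heckeRight (i j : B) :
    Commute (cs.heckeLeft q (cs.simple i)) (cs.heckeRight q (cs.simple j)) := by
  refine (cs.heckeBasis q).ext fun w => ?_
  change cs.heckeLeft q (cs.simple i) (cs.heckeRight q (cs.simple j) (cs.heckeT q w)) =
    cs.heckeRight q (cs.simple j) (cs.heckeLeft q (cs.simple i) (cs.heckeT q w))
  have hx := cs.length_simple_mul w i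
  have hy := cs.length_mul_simple w j
  have hz := cs.length_mul_simple (cs.simple i * w) j
  have hz' := cs.length_simple_mul (w * cs.simple j) i
  have key := cs.simple_mul_eq_mul_simple (w := w) (i := i) (j := j)
  have ha : cs.simple i * (w * cs.simple j) = cs.simple i * w * cs.simple j := by rw [mul_assoc]
  rw [ha] at hz'
  have l1 := cs.heckeLeft_of_lt q (s := cs.simple i) (w := w)
  have l2 := cs.heckeLeft_of_not_lt q (s := cs.simple i) (w := w)
  have l3 := cs.heckeLeft_of_lt q (s := cs.simple i) (w := w * cs.simple j)
  have l4 := cs.heckeLeft_of_not_lt q (s := cs.simple i) (w := w * cs.simple j)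
  have r1 := cs.heckeRight_of_lt q (s := cs.simple j) (w := w)
  have r2 := cs.heckeRight_of_not_lt q (s := cs.simple j) (w := w)
  have r3 := cs.heckeRight_of_lt q (s := cs.simple j) (w := cs.simple i * w)
  have r4 := cs.heckeRight_of_not_lt q (s := cs.simple j) (w := cs.simple i * w)
  rw [ha] at l3 l4
  rcases hx with hx | hx <;> rcases hy with hy | hy
  · rw [r1 (by omega), l1 (by omega)]
    rcases hz with hz | hz
    · rw [l3 (by omega), r3 (by omega)]
    · rw [l4 (by omega), r4 (by omega), key (by omega) (by omega)]
  · rw [r2 (by omega), l1 (by omega), map_add, map_smul, map_smul, l1 (by omega), l3 (by omega),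
      r4 (by omega)]
  · rw [r1 (by omega), l2 (by omega), map_add, map_smul, map_smul, r1 (by omega), r3 (by omega),
      l4 (by omega)]
  · rw [r2 (by omega), l2 (by omega), map_add, map_smul, map_smul, map_add, map_smul, map_smul,
      l2 (by omega), r2 (by omega)]
    rcases hz with hz | hz
    · rw [l3 (by omega), r3 (by omega), key (by omega) (by omega)]
    · rw [l4 (by omega), r4 (by omega)]
      module

/-- The operator of left multiplication by `T_w`, as a product of the operators `heckeLeft` over
a reduced word for `w`. -/
def heckeOp (w : W) : Module.End ℂ (cs.HeckeAlgebra q) :=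
  ((Classical.choose (cs.exists_isReduced w)).map fun i => cs.heckeLeft q (cs.simple i)).prod

/-- The linear extension of `T_w ↦ heckeOp w`. -/
def heckeLeftMul : cs.HeckeAlgebra q →ₗ[ℂ] Module.End ℂ (cs.HeckeAlgebra q) :=
  (cs.heckeBasis q).constr ℂ (cs.heckeOp q)

theorem heckeLeftMul_heckeT (w : W) : cs.heckeLeftMul q (cs.heckeT q w) = cs.heckeOp q w := by
  simp [heckeLeftMul, heckeT]

/-- The algebra of operators generated by the `heckeLeft` operators of the simple reflections. -/
def heckeLeftAlg : Subalgebra ℂ (Module.End ℂ (cs.HeckeAlgebra q)) :=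
  Algebra.adjoin ℂ (Set.range fun i => cs.heckeLeft q (cs.simple i))

theorem heckeLeftMul_mem (f : cs.HeckeAlgebra q) : cs.heckeLeftMul q f ∈ cs.heckeLeftAlg q := by
  rw [heckeLeftMul, Module.Basis.constr_apply]
  refine Subalgebra.sum_mem _ fun w _ => Subalgebra.smul_mem _ ?_ _
  refine Subalgebra.list_prod_mem _ fun x hx => ?_
  obtain ⟨i, _, rfl⟩ := List.mem_map.1 hx
  exact Algebra.subset_adjoin ⟨i, rfl⟩

theorem list_prod_heckeLeft_one (ω : List B) (h : cs.IsReduced ω) :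
    (ω.map fun i => cs.heckeLeft q (cs.simple i)).prod (cs.heckeT q 1) =
      cs.heckeT q (cs.wordProd ω) := by
  induction ω with
  | nil => simp
  | cons i ω ih =>
    have h' : cs.IsReduced ω := by simpa using h.drop 1
    rw [List.map_cons, List.prod_cons, Module.End.mul_apply, ih h', heckeLeft_of_lt, wordProd_cons]
    rw [← wordProd_cons, h.eq, h'.eq]; simp

theorem heckeLeftMul_one (f : cs.HeckeAlgebra q) : cs.heckeLeftMul q f (cs.heckeT q 1) = f := by
  have : (LinearMap.applyₗ (cs.heckeT q 1)).comp (cs.heckeLeftMul q) = LinearMap.id := by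
    refine (cs.heckeBasis q).ext fun w => ?_
    change cs.heckeLeftMul q (cs.heckeT q w) (cs.heckeT q 1) = cs.heckeT q w
    have h := Classical.choose_spec (cs.exists_isReduced w)
    rw [heckeLeftMul_heckeT, heckeOp, list_prod_heckeLeft_one _ _ _ h.1, ← h.2]
  exact LinearMap.congr_fun this f

theorem heckeLeftAlg_ext {a b : Module.End ℂ (cs.HeckeAlgebra q)} (ha : a ∈ cs.heckeLeftAlg q)
    (hb : b ∈ cs.heckeLeftAlg q) (h : a (cs.heckeT q 1) = b (cs.heckeT q 1)) : a = b := by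
  have hcomm : ∀ c ∈ cs.heckeLeftAlg q, ∀ j, Commute c (cs.heckeRight q (cs.simple j)) := by
    intro c hc j
    induction hc using Algebra.adjoin_induction with
    | mem x hx => obtain ⟨i, rfl⟩ := hx; exact cs.commute_heckeLeft_heckeRight q i j
    | algebraMap r => exact Algebra.commutes r _
    | add x y _ _ hx hy => exact hx.add_left hy
    | mul x y _ _ hx hy => exact hx.mul_left hy
  have key : ∀ ω : List B, cs.IsReduced ω →
      a (cs.heckeT q (cs.wordProd ω)) = b (cs.heckeT q (cs.wordProd ω)) := by
    intro ω
    induction ω using List.reverseRecOn with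
    | nil => intro _; simpa using h
    | append_singleton ω j ih =>
      intro hω
      have h' : cs.IsReduced ω := by simpa using hω.take ω.length
      have hlt : cs.length (cs.wordProd ω) < cs.length (cs.wordProd ω * cs.simple j) := by
        have := hω.eq
        rw [wordProd_append, wordProd_singleton] at this
        rw [this, h'.eq]; simp
      have e : cs.heckeT q (cs.wordProd (ω ++ [j])) =
          cs.heckeRight q (cs.simple j) (cs.heckeT q (cs.wordProd ω)) := by
        rw [heckeRight_of_lt _ _ hlt, wordProd_append, wordProd_singleton]
      have e1 := LinearMap.congr_fun (hcomm a ha j) (cs.heckeT q (cs.wordProd ω))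
      have e2 := LinearMap.congr_fun (hcomm b hb j) (cs.heckeT q (cs.wordProd ω))
      rw [Module.End.mul_apply, Module.End.mul_apply] at e1 e2
      rw [e, e1, e2, ih h']
  refine (cs.heckeBasis q).ext fun w => ?_
  obtain ⟨ω, hω, rfl⟩ := cs.exists_isReduced w
  exact key ω hω

/-- The product `f * g = ∑ f_w (heckeOp w) g`.  It is bilinear and associative with unit `T_1`, and it
is determined by the rules for `T_s T_w` with `s` simple, proved in `heckeT_simple_mul_of_lt` and
`heckeT_simple_mul_of_gt` below. -/
instance : Mul (cs.HeckeAlgebra q) := ⟨fun f g => cs.heckeLeftMul q f g⟩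

instance : One (cs.HeckeAlgebra q) := ⟨cs.heckeT q 1⟩

theorem hecke_mul_def (f g : cs.HeckeAlgebra q) : f * g = cs.heckeLeftMul q f g := rfl

theorem heckeT_one : cs.heckeT q 1 = 1 := rfl

theorem heckeLeftMul_mul (f g : cs.HeckeAlgebra q) :
    cs.heckeLeftMul q (f * g) = cs.heckeLeftMul q f * cs.heckeLeftMul q g := by
  refine cs.heckeLeftAlg_ext q (cs.heckeLeftMul_mem q _)
    (mul_mem (cs.heckeLeftMul_mem q _) (cs.heckeLeftMul_mem q _)) ?_
  rw [heckeLeftMul_one, Module.End.mul_apply, heckeLeftMul_one, hecke_mul_def]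

theorem heckeLeftMul_one_eq : cs.heckeLeftMul q 1 = 1 :=
  cs.heckeLeftAlg_ext q (cs.heckeLeftMul_mem q _) (one_mem _) (cs.heckeLeftMul_one q _)

instance : Ring (cs.HeckeAlgebra q) :=
  { (inferInstance : AddCommGroup (cs.HeckeAlgebra q)),
    (inferInstance : Mul (cs.HeckeAlgebra q)), (inferInstance : One (cs.HeckeAlgebra q)) with
    left_distrib := fun f g h => map_add (cs.heckeLeftMul q f) g h
    right_distrib := fun f g h => by simp only [hecke_mul_def, map_add, LinearMap.add_apply]
    zero_mul := fun f => by simp only [hecke_mul_def, map_zero, LinearMap.zero_apply]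
    mul_zero := fun f => map_zero (cs.heckeLeftMul q f)
    mul_assoc := fun f g h => by
      rw [hecke_mul_def, heckeLeftMul_mul]; rfl
    one_mul := fun f => by rw [hecke_mul_def, heckeLeftMul_one_eq]; rfl
    mul_one := fun f => cs.heckeLeftMul_one q f }

instance : Algebra ℂ (cs.HeckeAlgebra q) :=
  Algebra.ofModule
    (fun r f g => by simp only [hecke_mul_def, map_smul, LinearMap.smul_apply])
    (fun r f g => map_smul (cs.heckeLeftMul q f) r g)

theorem heckeT_simple_mul (i : B) (f : cs.HeckeAlgebra q) :
    cs.heckeT q (cs.simple i) * f = cs.heckeLeft q (cs.simple i) f := by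
  refine LinearMap.congr_fun (cs.heckeLeftAlg_ext q (cs.heckeLeftMul_mem q _)
    (Algebra.subset_adjoin ⟨i, rfl⟩) ?_) f
  rw [heckeLeftMul_one, heckeLeft_of_lt _ _ (by simp), mul_one]

/-- The defining multiplication rule of the Iwahori-Hecke algebra, first case. -/
theorem heckeT_simple_mul_of_lt (i : B) (w : W)
    (h : cs.length (cs.simple i * w) = cs.length w + 1) :
    cs.heckeT q (cs.simple i) * cs.heckeT q w = cs.heckeT q (cs.simple i * w) := by
  rw [heckeT_simple_mul, heckeLeft_of_lt _ _ (by omega)]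

/-- The defining multiplication rule of the Iwahori-Hecke algebra, second case. -/
theorem heckeT_simple_mul_of_gt (i : B) (w : W)
    (h : cs.length (cs.simple i * w) + 1 = cs.length w) :
    cs.heckeT q (cs.simple i) * cs.heckeT q w =
      ((q : ℂ) - 1) • cs.heckeT q w + (q : ℂ) • cs.heckeT q (cs.simple i * w) := by
  rw [heckeT_simple_mul, heckeLeft_of_not_lt _ _ (by omega)]

end Algebra

section Trace

variable {B W : Type*} [Group W] [Fintype W] {M : CoxeterMatrix B} (cs : CoxeterSystem M W)

/-- The Poincaré polynomial `P_W(q) = ∑_w q^ℓ(w)`. -/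
def poincare (q : ℝ) : ℝ := ∑ w : W, q ^ cs.length w

/-- The probability distribution `π(w) = θ^(-ℓ(w)) / P_W(θ⁻¹)` on `W`. -/
def lengthDistribution (θ : ℝ) (w : W) : ℝ := θ⁻¹ ^ cs.length w / cs.poincare θ⁻¹

/-- The normalized basis element `q^(-ℓ(w)) T_w`. -/
def heckeTNormalized (q : ℝ) (w : W) : cs.HeckeAlgebra q :=
  ((q : ℂ) ^ cs.length w)⁻¹ • cs.heckeT q w

/-- The trace on the Iwahori-Hecke algebra with `T_1 ↦ P_W(q)` and `T_w ↦ 0` for `w ≠ 1`. -/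
def heckeTrace (q : ℝ) : cs.HeckeAlgebra q →ₗ[ℂ] ℂ :=
  (cs.poincare q : ℂ) • (cs.heckeBasis q).coord 1

open Classical in
theorem heckeTrace_heckeT (q : ℝ) (w : W) :
    cs.heckeTrace q (cs.heckeT q w) = if w = 1 then (cs.poincare q : ℂ) else 0 := by
  simp [heckeTrace, heckeT, Finsupp.single_apply]

/-- The matrix `K` is the matrix of left multiplication by `k` in the basis of normalized `T_w`:
the row of `x` holds the coefficients of `k` times the normalized `T_x`. -/
def IsLeftMulMatrix {q : ℝ} (k : cs.HeckeAlgebra q) (K : Matrix W W ℝ) : Prop :=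
  ∀ x, k * cs.heckeTNormalized q x = ∑ y, (K x y : ℂ) • cs.heckeTNormalized q y

end Trace

end

end CoxeterSystem

namespace MarkovChain

variable {X : Type*} [Fintype X]

/-- Reversibility (detailed balance) of the matrix `K` with respect to `π`. -/
def IsReversible (π : X → ℝ) (K : Matrix X X ℝ) : Prop :=
  ∀ x y, π x * K x y = π y * K y x

/-- The inner product `⟨f, g⟩ = ∑ f(x) g(x) π(x)` of `L²(π)`. -/
def innerL2 (π f g : X → ℝ) : ℝ := ∑ x, f x * g x * π x

/-- The squared `L²(π)` norm of `K_x^n / π - 1`, where `K_x^n(y) = K^n(x, y)` is the law after `n`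
steps of the chain started at `x`. -/
noncomputable def sqDist [DecidableEq X] (π : X → ℝ) (K : Matrix X X ℝ) (n : ℕ) (x : X) : ℝ :=
  innerL2 π (fun y => (K ^ n) x y / π y - 1) (fun y => (K ^ n) x y / π y - 1)

end MarkovChain

/-- An isomorphism of a complex algebra with a finite direct sum of matrix algebras
`M_{d_i}(ℂ)`, `d_i > 0`.  Its index set labels the isomorphism classes of irreducible
representations of the algebra. -/
structure MatrixDecomposition (A : Type*) [Ring A] [Algebra ℂ A] where
  Index : Type
  [fintypeIndex : Fintype Index]
  [decEqIndex : DecidableEq Index]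
  /-- The dimension of the irreducible representation with label `i`. -/
  dim : Index → ℕ
  dim_pos : ∀ i, 0 < dim i
  equiv : A ≃ₐ[ℂ] (∀ i, Matrix (Fin (dim i)) (Fin (dim i)) ℂ)

namespace MatrixDecomposition

attribute [instance] fintypeIndex decEqIndex

variable {A : Type*} [Ring A] [Algebra ℂ A] (D : MatrixDecomposition A)

/-- The irreducible representation with label `i`. -/
def rep (i : D.Index) : A →ₐ[ℂ] Matrix (Fin (D.dim i)) (Fin (D.dim i)) ℂ :=
  (Pi.evalAlgHom ℂ (fun i => Matrix (Fin (D.dim i)) (Fin (D.dim i)) ℂ) i).comp D.equiv.toAlgHom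

/-- The irreducible character with label `i`. -/
def character (i : D.Index) (a : A) : ℂ := (D.rep i a).trace

/-- The numbers `t_i` are the coefficients of `τ` in the irreducible characters.  For the trace
`heckeTrace` of the Iwahori-Hecke algebra, these are the generic degrees. -/
def IsTraceExpansion (τ : A →ₗ[ℂ] ℂ) (t : D.Index → ℂ) : Prop :=
  ∀ a, τ a = ∑ i, t i * D.character i a

variable {B W : Type*} [Group W] {M : CoxeterMatrix B} {cs : CoxeterSystem M W} {q : ℝ}

/-- The label `i` is that of the trivial representation of the Iwahori-Hecke algebra, the
one-dimensional representation `T_w ↦ q^ℓ(w)`. -/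
def IsTrivialIndex (D : MatrixDecomposition (cs.HeckeAlgebra q)) (i : D.Index) : Prop :=
  D.dim i = 1 ∧ ∀ w, D.character i (cs.heckeT q w) = (q : ℂ) ^ cs.length w

end MatrixDecomposition

/-! ### Products over reduced words and the index representation. -/

namespace CoxeterSystem

noncomputable section

variable {B W : Type*} [Group W] {M : CoxeterMatrix B} (cs : CoxeterSystem M W) (q : ℝ)

/-! For a reversible chain the squared distance collapses to a return probability: it equals
`K^{2n}(x,x)/π(x) - 1` (`MarkovChain.sqDist_eq`). The rest reads this number inside the Hecke
algebra. The trace functional pairs `T_{x⁻¹}` with `T_x` dually, so the trace of `T_{x⁻¹} k^{2n}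
T_x` is `P_W(q) q^{ℓ(x)} K^{2n}(x,x)`; expanding the trace in characters gives (a). Averaging over
`π` gives the matrix trace of `K^{2n}` minus 1; the former is the trace of left multiplication by
`k^{2n}`, hence `∑ d_λ χ_λ(k^{2n})`, which gives (b). In both cases the subtracted 1 is the trivial
term: row sums 1 mean that `k` has index 1, and the trivial generic degree is 1
(`IsTrivialIndex.coeff_eq_one`).

The structure behind this is a positive definite form for which the adjoint of left multiplication
by `T_w` is that by `T_{w⁻¹}`. It yields semisimplicity, the symmetry of the trace, and the fact
that `∑ T_w` spans a copy of the index representation. -/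

theorem heckeT_wordProd {ω : List B} (h : cs.IsReduced ω) :
    cs.heckeT q (cs.wordProd ω) = (ω.map fun i => cs.heckeT q (cs.simple i)).prod := by
  induction ω with
  | nil => simp [heckeT_one]
  | cons i ω ih =>
    have h' : cs.IsReduced ω := by simpa using h.drop 1
    rw [List.map_cons, List.prod_cons, ← ih h', wordProd_cons, heckeT_simple_mul_of_lt]
    rw [← wordProd_cons, h.eq, h'.eq, List.length_cons]

theorem heckeAlgebra_induction {p : cs.HeckeAlgebra q → Prop} (zero : p 0)
    (basis : ∀ w, p (cs.heckeT q w)) (add : ∀ a b, p a → p b → p (a + b))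
    (smul : ∀ (c : ℂ) a, p a → p (c • a)) (a : cs.HeckeAlgebra q) : p a := by
  have ha : a ∈ Submodule.span ℂ (Set.range (cs.heckeBasis q)) :=
    (cs.heckeBasis q).mem_span a
  induction ha using Submodule.span_induction with
  | mem x hx => obtain ⟨w, rfl⟩ := hx; exact basis w
  | zero => exact zero
  | add a b _ _ ha hb => exact add a b ha hb
  | smul c a _ ha => exact smul c a ha

/-- The linear functional `T_w ↦ q^ℓ(w)`. -/
def heckeIndexₗ : cs.HeckeAlgebra q →ₗ[ℂ] ℂ :=
  (cs.heckeBasis q).constr ℂ fun w => (q : ℂ) ^ cs.length w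

theorem heckeIndexₗ_heckeT (w : W) :
    cs.heckeIndexₗ q (cs.heckeT q w) = (q : ℂ) ^ cs.length w := by
  rw [heckeIndexₗ, heckeT, Module.Basis.constr_basis]

/-- At a descent this is `(q-1) q^ℓ + q · q^(ℓ-1) = q · q^ℓ`. Multiplicativity of the index on the
whole algebra follows along reduced words. -/
theorem heckeIndexₗ_heckeLeft (i : B) (f : cs.HeckeAlgebra q) :
    cs.heckeIndexₗ q (cs.heckeLeft q (cs.simple i) f) = q * cs.heckeIndexₗ q f := by
  have key : cs.heckeIndexₗ q ∘ₗ cs.heckeLeft q (cs.simple i) = (q : ℂ) • cs.heckeIndexₗ q := by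
    refine (cs.heckeBasis q).ext fun w => ?_
    change cs.heckeIndexₗ q (cs.heckeLeft q (cs.simple i) (cs.heckeT q w)) =
      q * cs.heckeIndexₗ q (cs.heckeT q w)
    rcases cs.length_simple_mul w i with h | h
    · rw [heckeLeft_of_lt _ _ (by omega), heckeIndexₗ_heckeT, heckeIndexₗ_heckeT, h, pow_succ']
    · rw [heckeLeft_of_not_lt _ _ (by omega), map_add, map_smul, map_smul, heckeIndexₗ_heckeT,
        heckeIndexₗ_heckeT, ← h, smul_eq_mul, smul_eq_mul]
      ring
  exact LinearMap.congr_fun key f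

theorem heckeIndexₗ_heckeT_mul (w : W) (f : cs.HeckeAlgebra q) :
    cs.heckeIndexₗ q (cs.heckeT q w * f) = (q : ℂ) ^ cs.length w * cs.heckeIndexₗ q f := by
  obtain ⟨ω, hω, rfl⟩ := cs.exists_isReduced w
  rw [heckeT_wordProd _ _ hω, hω.eq]
  clear hω
  induction ω with
  | nil => simp
  | cons i ω ih =>
    rw [List.map_cons, List.prod_cons, mul_assoc, heckeT_simple_mul, heckeIndexₗ_heckeLeft, ih,
      List.length_cons, pow_succ']
    ring

/-- The one-dimensional representation `T_w ↦ q^ℓ(w)` of the Iwahori-Hecke algebra. -/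
def heckeIndex : cs.HeckeAlgebra q →ₐ[ℂ] ℂ :=
  AlgHom.ofLinearMap (cs.heckeIndexₗ q)
    (by rw [← heckeT_one, heckeIndexₗ_heckeT]; simp)
    (fun a b => by
      induction a using cs.heckeAlgebra_induction q with
      | zero => simp
      | basis w =>
        change cs.heckeIndexₗ q (cs.heckeT q w * b) = cs.heckeIndexₗ q (cs.heckeT q w) * _
        rw [heckeIndexₗ_heckeT_mul, heckeIndexₗ_heckeT]
      | add a b ha hb => simp only [add_mul, map_add, ha, hb]
      | smul c a ha => simp only [smul_mul_assoc, map_smul, ha])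

theorem heckeIndex_heckeT (w : W) : cs.heckeIndex q (cs.heckeT q w) = (q : ℂ) ^ cs.length w :=
  cs.heckeIndexₗ_heckeT q w

/-! ### The positive definite form and semisimplicity. -/

variable [Fintype W]

instance : FiniteDimensional ℂ (cs.HeckeAlgebra q) := Module.Finite.of_basis (cs.heckeBasis q)

/-- The sesquilinear form on the Iwahori-Hecke algebra for which the `T_w` are orthogonal, of
squared norm `q^ℓ(w)`. -/
def heckeForm : cs.HeckeAlgebra q →ₗ⋆[ℂ] cs.HeckeAlgebra q →ₗ[ℂ] ℂ :=
  LinearMap.mk₂'ₛₗ (starRingEnd ℂ) (RingHom.id ℂ)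
    (fun f g => ∑ w, (q : ℂ) ^ cs.length w *
      (starRingEnd ℂ ((cs.heckeBasis q).repr f w) * (cs.heckeBasis q).repr g w))
    (fun f f' g => by
      simp only [map_add, Finsupp.add_apply, add_mul, mul_add, Finset.sum_add_distrib])
    (fun c f g => by
      simp only [map_smul, Finsupp.smul_apply, smul_eq_mul, map_mul, Finset.mul_sum]
      exact Finset.sum_congr rfl fun w _ => by ring)
    (fun f g g' => by
      simp only [map_add, Finsupp.add_apply, mul_add, Finset.sum_add_distrib])
    (fun c f g => by
      simp only [map_smul, Finsupp.smul_apply, smul_eq_mul, Finset.mul_sum, RingHom.id_apply]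
      exact Finset.sum_congr rfl fun w _ => by ring)

theorem heckeForm_apply (f g : cs.HeckeAlgebra q) : cs.heckeForm q f g =
    ∑ w, (q : ℂ) ^ cs.length w *
      (starRingEnd ℂ ((cs.heckeBasis q).repr f w) * (cs.heckeBasis q).repr g w) := rfl

theorem heckeForm_heckeT_left (x : W) (g : cs.HeckeAlgebra q) :
    cs.heckeForm q (cs.heckeT q x) g = (q : ℂ) ^ cs.length x * (cs.heckeBasis q).repr g x := by
  classical
  rw [heckeForm_apply, Finset.sum_eq_single x]
  · simp [heckeT]
  · intro y _ h; simp [heckeT, h.symm]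
  · simp

open Classical in
theorem heckeForm_heckeT_heckeT (x y : W) :
    cs.heckeForm q (cs.heckeT q x) (cs.heckeT q y) =
      if x = y then (q : ℂ) ^ cs.length x else 0 := by
  rw [heckeForm_heckeT_left]
  simp [heckeT, Finsupp.single_apply, eq_comm]

variable {q} in
theorem eq_zero_of_heckeForm_self (hq : 0 < q) {f : cs.HeckeAlgebra q}
    (h : cs.heckeForm q f f = 0) : f = 0 := by
  have h2 : ∑ w, q ^ cs.length w * Complex.normSq ((cs.heckeBasis q).repr f w) = 0 := by
    rw [heckeForm_apply] at h
    simp only [← Complex.normSq_eq_conj_mul_self] at h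
    exact_mod_cast h
  rw [Finset.sum_eq_zero_iff_of_nonneg
    fun w _ => mul_nonneg (pow_pos hq _).le (Complex.normSq_nonneg _)] at h2
  refine (cs.heckeBasis q).repr.map_eq_zero_iff.1 (Finsupp.ext fun w => ?_)
  have := h2 w (Finset.mem_univ w)
  rw [mul_eq_zero, or_iff_right (pow_pos hq _).ne', Complex.normSq_eq_zero] at this
  exact this

/-- The operator preserves each plane spanned by `T_x` and `T_{sx}`. If `sx` is the longer element,
the off-diagonal coefficients are 1 and `q`, exactly balanced by the squared norms `q^ℓ(x)` and
`q^(ℓ(x)+1)`; the diagonal ones are real. -/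
theorem heckeForm_heckeLeft (i : B) (f g : cs.HeckeAlgebra q) :
    cs.heckeForm q (cs.heckeLeft q (cs.simple i) f) g =
      cs.heckeForm q f (cs.heckeLeft q (cs.simple i) g) := by
  classical
  have key : (cs.heckeForm q).comp (cs.heckeLeft q (cs.simple i)) =
      (cs.heckeForm q).compl₂ (cs.heckeLeft q (cs.simple i)) := by
    refine (cs.heckeBasis q).ext fun x => (cs.heckeBasis q).ext fun y => ?_
    change cs.heckeForm q (cs.heckeLeft q (cs.simple i) (cs.heckeT q x)) (cs.heckeT q y) =
      cs.heckeForm q (cs.heckeT q x) (cs.heckeLeft q (cs.simple i) (cs.heckeT q y))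
    have hxy : cs.simple i * x = y ↔ x = cs.simple i * y := by
      constructor <;> rintro rfl <;> simp
    have hx := cs.length_simple_mul x i
    have hy := cs.length_simple_mul y i
    by_cases h1 : cs.length x < cs.length (cs.simple i * x) <;>
    by_cases h2 : cs.length y < cs.length (cs.simple i * y)
    · rw [heckeLeft_of_lt _ _ h1, heckeLeft_of_lt _ _ h2, heckeForm_heckeT_heckeT,
        heckeForm_heckeT_heckeT]
      by_cases h : cs.simple i * x = y
      · subst h; simp at h2; omega
      · rw [if_neg h, if_neg (hxy.not.1 h)]
    · rw [heckeLeft_of_lt _ _ h1, heckeLeft_of_not_lt _ _ h2]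
      simp only [map_add, map_smul, heckeForm_heckeT_heckeT, smul_eq_mul]
      have hne : x ≠ y := by rintro rfl; exact h2 h1
      rw [if_neg hne]
      by_cases h : cs.simple i * x = y
      · rw [if_pos h, if_pos (hxy.1 h), show cs.length (cs.simple i * x) = cs.length x + 1 by omega]
        ring
      · rw [if_neg h, if_neg (hxy.not.1 h)]; ring
    · rw [heckeLeft_of_not_lt _ _ h1, heckeLeft_of_lt _ _ h2]
      simp only [map_add, map_smulₛₗ, LinearMap.add_apply, LinearMap.smul_apply,
        heckeForm_heckeT_heckeT, smul_eq_mul]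
      have hne : x ≠ y := by rintro rfl; exact h1 h2
      rw [if_neg hne]
      by_cases h : cs.simple i * x = y
      · rw [if_pos h, if_pos (hxy.1 h), show cs.length x = cs.length (cs.simple i * x) + 1 by omega]
        simp; ring
      · rw [if_neg h, if_neg (hxy.not.1 h)]; ring
    · rw [heckeLeft_of_not_lt _ _ h1, heckeLeft_of_not_lt _ _ h2]
      simp only [map_add, map_smulₛₗ, LinearMap.add_apply, LinearMap.smul_apply,
        heckeForm_heckeT_heckeT, smul_eq_mul]
      have hne : ¬ cs.simple i * x = y := by rintro rfl; simp at h2; omega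
      rw [if_neg hne, if_neg (hxy.not.1 hne)]
      simp
  exact LinearMap.congr_fun (LinearMap.congr_fun key f) g

/-- Left multiplications by `T_w` and `T_{w⁻¹}` are adjoint. -/
theorem heckeForm_heckeT_mul (w : W) (f g : cs.HeckeAlgebra q) :
    cs.heckeForm q (cs.heckeT q w * f) g = cs.heckeForm q f (cs.heckeT q w⁻¹ * g) := by
  obtain ⟨ω, hω, rfl⟩ := cs.exists_isReduced w
  rw [← wordProd_reverse, heckeT_wordProd _ _ hω,
    heckeT_wordProd _ _ ((cs.isReduced_reverse_iff ω).2 hω)]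
  clear hω
  induction ω generalizing f g with
  | nil => simp
  | cons i ω ih =>
    rw [List.map_cons, List.prod_cons, mul_assoc, heckeT_simple_mul, heckeForm_heckeLeft, ih,
      ← heckeT_simple_mul]
    simp [mul_assoc]

/-- Extends the adjunction between `T_w` and `T_{w⁻¹}` conjugate-linearly. The radical argument
needs only that an adjoint exists, not that it is multiplicative. -/
theorem exists_heckeForm_mul (a : cs.HeckeAlgebra q) : ∃ a' : cs.HeckeAlgebra q,
    ∀ f g, cs.heckeForm q (a * f) g = cs.heckeForm q f (a' * g) := by
  induction a using cs.heckeAlgebra_induction q with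
  | zero => exact ⟨0, by simp⟩
  | basis w => exact ⟨_, cs.heckeForm_heckeT_mul q w⟩
  | add a b ha hb =>
    obtain ⟨a', ha⟩ := ha
    obtain ⟨b', hb⟩ := hb
    exact ⟨a' + b', fun f g => by simp only [add_mul, map_add, LinearMap.add_apply, ha, hb]⟩
  | smul c a ha =>
    obtain ⟨a', ha⟩ := ha
    exact ⟨starRingEnd ℂ c • a', fun f g => by
      simp only [smul_mul_assoc, map_smulₛₗ, LinearMap.smul_apply, ha, RingHom.id_apply]⟩

-- A self-adjoint nilpotent element vanishes under a positive definite form. For `a` in the radical,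
-- `a' * a` is self-adjoint and nilpotent, hence zero, and then `⟨a, a⟩ = ⟨1, a' a⟩ = 0`.
variable {q} in
theorem heckeAlgebra_isSemisimpleRing (hq : 0 < q) : IsSemisimpleRing (cs.HeckeAlgebra q) := by
  have hA : IsArtinianRing (cs.HeckeAlgebra q) := IsArtinianRing.of_finite ℂ _
  rw [IsArtinianRing.isSemisimpleRing_iff_jacobson, ← Ideal.jacobson_bot, eq_bot_iff]
  intro a ha
  obtain ⟨a', ha'⟩ := cs.exists_heckeForm_mul q a
  have hself : ∀ n f g, cs.heckeForm q ((a' * a) ^ n * f) g =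
      cs.heckeForm q f ((a' * a) ^ n * g) := by
    have h1 : ∀ f g, cs.heckeForm q (a' * a * f) g = cs.heckeForm q f (a' * a * g) := by
      intro f g
      rw [mul_assoc, mul_assoc, ← ha']
      have hsymm : ∀ f g, starRingEnd ℂ (cs.heckeForm q f g) = cs.heckeForm q g f := by
        intro f g
        simp only [heckeForm_apply, map_sum, map_mul, map_pow, Complex.conj_ofReal,
          Complex.conj_conj]
        exact Finset.sum_congr rfl fun w _ => by ring
      rw [← hsymm, ← ha', hsymm]
    intro n
    induction n with
    | zero => simp
    | succ n ih =>
      intro f g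
      rw [pow_succ, mul_assoc, ih, h1, ← mul_assoc, ← pow_succ', pow_succ]
  -- With `b = a' * a`, the exponent can be halved: `⟨b^m, b^m⟩ = ⟨1, b^(2m)⟩`. Powers of two make
  -- the descent end at exponent 1.
  have hred : ∀ k, (a' * a) ^ (2 ^ k) = 0 → a' * a = 0 := by
    intro k
    induction k with
    | zero => simp
    | succ k ih =>
      intro h
      refine ih (cs.eq_zero_of_heckeForm_self hq ?_)
      have := hself (2 ^ k) 1 ((a' * a) ^ (2 ^ k))
      rw [mul_one, ← pow_add, ← two_mul, ← pow_succ', h, map_zero] at this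
      exact this
  have hmem : a' * a ∈ Ideal.jacobson (⊥ : Ideal (cs.HeckeAlgebra q)) :=
    Ideal.mul_mem_left _ _ ha
  obtain ⟨n, hn⟩ := IsArtinianRing.isNilpotent_jacobson_bot (R := cs.HeckeAlgebra q)
  have hnil : (a' * a) ^ n = 0 := by
    have := Ideal.pow_mem_pow hmem n
    rw [hn] at this
    exact this
  have hz := hred n (pow_eq_zero_of_le Nat.lt_two_pow_self.le hnil)
  refine cs.eq_zero_of_heckeForm_self hq ?_
  have := ha' 1 a
  rwa [mul_one, hz, map_zero] at this

/-! ### The trace functional and the sum of the standard basis. -/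

theorem heckeTrace_eq_heckeForm (a : cs.HeckeAlgebra q) :
    cs.heckeTrace q a = cs.poincare q * cs.heckeForm q 1 a := by
  rw [← heckeT_one, heckeForm_heckeT_left]
  simp [heckeTrace]

/-- Up to scalars, `T_{x⁻¹}` is dual to `T_x` under the trace: moving it across the form turns the
trace into a pairing with `T_x`. -/
theorem heckeTrace_heckeT_mul (x : W) (a : cs.HeckeAlgebra q) :
    cs.heckeTrace q (cs.heckeT q x⁻¹ * a) =
      cs.poincare q * ((q : ℂ) ^ cs.length x * (cs.heckeBasis q).repr a x) := by
  rw [heckeTrace_eq_heckeForm, ← heckeForm_heckeT_mul, mul_one, heckeForm_heckeT_left]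

/-- On basis elements the duality leaves only `y = x⁻¹`, with value `P_W(q) q^ℓ(x)`; this is
symmetric because `ℓ(x⁻¹) = ℓ(x)`. -/
theorem heckeTrace_mul_comm (a b : cs.HeckeAlgebra q) :
    cs.heckeTrace q (a * b) = cs.heckeTrace q (b * a) := by
  classical
  have key : (LinearMap.mul ℂ (cs.HeckeAlgebra q)).compr₂ (cs.heckeTrace q) =
      (LinearMap.mul ℂ (cs.HeckeAlgebra q)).flip.compr₂ (cs.heckeTrace q) := by
    refine (cs.heckeBasis q).ext fun x => (cs.heckeBasis q).ext fun y => ?_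
    change cs.heckeTrace q (cs.heckeT q x * cs.heckeT q y) =
      cs.heckeTrace q (cs.heckeT q y * cs.heckeT q x)
    have h (x y : W) : cs.heckeTrace q (cs.heckeT q x * cs.heckeT q y) =
        if y = x⁻¹ then cs.poincare q * (q : ℂ) ^ cs.length x else 0 := by
      have := cs.heckeTrace_heckeT_mul q x⁻¹ (cs.heckeT q y)
      rw [inv_inv] at this
      rw [this, length_inv]
      simp [heckeT, Finsupp.single_apply]
    rw [h, h]
    by_cases hxy : y = x⁻¹
    · subst hxy; simp
    · rw [if_neg hxy, if_neg]
      rintro rfl; simp at hxy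
  exact LinearMap.congr_fun (LinearMap.congr_fun key a) b

/-- The sum of the standard basis elements spans a copy of the representation `T_w ↦ q^ℓ(w)`. -/
theorem mul_sum_heckeT (hq : 0 < q) (a : cs.HeckeAlgebra q) :
    a * ∑ w, cs.heckeT q w = cs.heckeIndex q a • ∑ w, cs.heckeT q w := by
  -- The squared norm of `T_w` equals its index, so pairing with the sum computes the conjugate
  -- index. Multiplicativity of the index and nondegeneracy of the form then give the eigenvector
  -- equation.
  have hform (f) : cs.heckeForm q f (∑ w, cs.heckeT q w) = starRingEnd ℂ (cs.heckeIndex q f) := by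
    induction f using cs.heckeAlgebra_induction q with
    | zero => simp
    | basis w =>
      classical
      simp [heckeForm_heckeT_heckeT, heckeIndex_heckeT]
    | add a b ha hb => simp only [map_add, LinearMap.add_apply, ha, hb]
    | smul c a ha => simp only [map_smulₛₗ, LinearMap.smul_apply, ha, smul_eq_mul, map_mul,
        RingHom.id_apply]
  induction a using cs.heckeAlgebra_induction q with
  | zero => simp
  | basis w =>
    change cs.heckeT q w * _ = cs.heckeIndex q (cs.heckeT q w) • _
    rw [← sub_eq_zero]
    have h0 : ∀ f, cs.heckeForm q f (cs.heckeT q w * (∑ w, cs.heckeT q w) -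
        cs.heckeIndex q (cs.heckeT q w) • ∑ w, cs.heckeT q w) = 0 := by
      intro f
      have := cs.heckeForm_heckeT_mul q w⁻¹ f (∑ w, cs.heckeT q w)
      rw [inv_inv] at this
      rw [map_sub, ← this, map_smul, hform, hform, map_mul (cs.heckeIndex q), heckeIndex_heckeT,
        heckeIndex_heckeT, length_inv]
      simp
    exact cs.eq_zero_of_heckeForm_self hq (h0 _)
  | add a b ha hb => simp only [add_mul, map_add, add_smul, ha, hb]
  | smul c a ha => simp only [smul_mul_assoc, map_smul, ha, smul_assoc]

theorem heckeIndex_sum_heckeT : cs.heckeIndex q (∑ w, cs.heckeT q w) = cs.poincare q := by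
  simp [heckeIndex_heckeT, poincare]

theorem heckeTrace_sum_heckeT : cs.heckeTrace q (∑ w, cs.heckeT q w) = cs.poincare q := by
  classical
  simp [heckeTrace_heckeT]

end

end CoxeterSystem

/-! ### Characters and traces on a direct sum of matrix algebras. -/

namespace MatrixDecomposition

variable {A : Type*} [Ring A] [Algebra ℂ A] (D : MatrixDecomposition A)

/-- The row and column index `0` of the block with label `i`. -/
def zeroIdx (i : D.Index) : Fin (D.dim i) := ⟨0, D.dim_pos i⟩

/-- The irreducible characters as linear functionals. -/
noncomputable def characterₗ (i : D.Index) : A →ₗ[ℂ] ℂ :=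
  (Matrix.traceLinearMap _ ℂ ℂ).comp (D.rep i).toLinearMap

/-- The element of `A` corresponding to a matrix in the block with label `i`. -/
noncomputable def ofBlock (i : D.Index) :
    Matrix (Fin (D.dim i)) (Fin (D.dim i)) ℂ →ₗ[ℂ] A :=
  D.equiv.symm.toLinearMap ∘ₗ
    LinearMap.single ℂ (fun i => Matrix (Fin (D.dim i)) (Fin (D.dim i)) ℂ) i

theorem equiv_ofBlock (i : D.Index) (m : Matrix (Fin (D.dim i)) (Fin (D.dim i)) ℂ) :
    D.equiv (D.ofBlock i m) = Pi.single i m := by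
  simp [ofBlock]

theorem rep_apply (i : D.Index) (a : A) : D.rep i a = D.equiv a i := rfl

theorem rep_ofBlock_same (i : D.Index) (m : Matrix (Fin (D.dim i)) (Fin (D.dim i)) ℂ) :
    D.rep i (D.ofBlock i m) = m := by
  rw [rep_apply, equiv_ofBlock, Pi.single_eq_same]

theorem rep_ofBlock_of_ne {i j : D.Index} (h : j ≠ i)
    (m : Matrix (Fin (D.dim i)) (Fin (D.dim i)) ℂ) : D.rep j (D.ofBlock i m) = 0 := by
  rw [rep_apply, equiv_ofBlock, Pi.single_eq_of_ne h]

theorem ext_rep {a b : A} (h : ∀ i, D.rep i a = D.rep i b) : a = b :=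
  D.equiv.injective (funext h)

theorem ofBlock_mul (i : D.Index) (m n : Matrix (Fin (D.dim i)) (Fin (D.dim i)) ℂ) :
    D.ofBlock i (m * n) = D.ofBlock i m * D.ofBlock i n := by
  refine D.ext_rep fun j => ?_
  rw [map_mul (D.rep j)]
  by_cases h : j = i
  · subst h; simp only [rep_ofBlock_same]
  · simp only [D.rep_ofBlock_of_ne h, mul_zero]

theorem ofBlock_mul_ofBlock_of_ne {i j : D.Index} (hij : i ≠ j)
    (m : Matrix (Fin (D.dim i)) (Fin (D.dim i)) ℂ) (n : Matrix (Fin (D.dim j)) (Fin (D.dim j)) ℂ) :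
    D.ofBlock i m * D.ofBlock j n = 0 := by
  refine D.ext_rep fun k => ?_
  rw [map_mul, map_zero]
  by_cases h : k = i
  · subst h; rw [D.rep_ofBlock_of_ne hij n, mul_zero]
  · rw [D.rep_ofBlock_of_ne h m, zero_mul]

theorem sum_ofBlock_rep (a : A) : ∑ i, D.ofBlock i (D.rep i a) = a := by
  refine D.ext_rep fun j => ?_
  rw [map_sum, Finset.sum_eq_single j, rep_ofBlock_same]
  · intro i _ h; exact D.rep_ofBlock_of_ne h.symm _
  · simp

theorem character_ofBlock_same (i : D.Index) (m : Matrix (Fin (D.dim i)) (Fin (D.dim i)) ℂ) :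
    D.character i (D.ofBlock i m) = m.trace := by
  rw [character, rep_ofBlock_same]

theorem character_ofBlock_of_ne {i j : D.Index} (h : j ≠ i)
    (m : Matrix (Fin (D.dim i)) (Fin (D.dim i)) ℂ) : D.character j (D.ofBlock i m) = 0 := by
  rw [character, D.rep_ofBlock_of_ne h, Matrix.trace_zero]

theorem IsTraceExpansion.apply_ofBlock {D : MatrixDecomposition A} {τ : A →ₗ[ℂ] ℂ}
    {t : D.Index → ℂ} (h : D.IsTraceExpansion τ t) (i : D.Index)
    (m : Matrix (Fin (D.dim i)) (Fin (D.dim i)) ℂ) : τ (D.ofBlock i m) = t i * m.trace := by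
  rw [h, Finset.sum_eq_single i, character_ofBlock_same]
  · intro j _ hj; rw [D.character_ofBlock_of_ne hj, mul_zero]
  · simp

/-- A rank-one idempotent in one block isolates that block's coefficient, which gives uniqueness of
the expansion. -/
theorem IsTraceExpansion.apply_single {D : MatrixDecomposition A} {τ : A →ₗ[ℂ] ℂ}
    {t : D.Index → ℂ} (h : D.IsTraceExpansion τ t) (i : D.Index) :
    τ (D.ofBlock i (Matrix.single (D.zeroIdx i) (D.zeroIdx i) 1)) = t i := by
  rw [h.apply_ofBlock, Matrix.trace_single_eq_same, mul_one]

theorem IsTraceExpansion.unique {D : MatrixDecomposition A} {τ : A →ₗ[ℂ] ℂ}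
    {t t' : D.Index → ℂ} (h : D.IsTraceExpansion τ t) (h' : D.IsTraceExpansion τ t') : t = t' :=
  funext fun i => by rw [← h.apply_single, ← h'.apply_single]

theorem character_injective {i j : D.Index} (h : ∀ a, D.character i a = D.character j a) :
    i = j := by
  by_contra hij
  have := h (D.ofBlock i (Matrix.single (D.zeroIdx i) (D.zeroIdx i) 1))
  rw [character_ofBlock_same, D.character_ofBlock_of_ne (Ne.symm hij),
    Matrix.trace_single_eq_same] at this
  exact one_ne_zero this

/-- A linear functional on matrices with `f (mn) = f (nm)` is a multiple of the trace. -/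
theorem _root_.Matrix.eq_smul_trace_of_mul_comm {n : Type*} [Fintype n] [DecidableEq n]
    (f : Matrix n n ℂ →ₗ[ℂ] ℂ) (hf : ∀ a b, f (a * b) = f (b * a)) (k : n) (m : Matrix n n ℂ) :
    f m = f (Matrix.single k k 1) * m.trace := by
  have h1 : ∀ r c, f (Matrix.single r c 1) = if r = c then f (Matrix.single k k 1) else 0 := by
    intro r c
    -- Swapping these factors gives `E_kk` if `r = c` and zero otherwise.
    have e : Matrix.single r c (1 : ℂ) = Matrix.single r k 1 * Matrix.single k c 1 := by simp
    rw [e, hf]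
    split_ifs with h
    · subst h; simp
    · rw [Matrix.single_mul_single_of_ne _ _ _ _ (Ne.symm h), map_zero]
  generalize f (Matrix.single k k 1) = t at h1 ⊢
  have h2 : ∀ r c, f (Matrix.single r c (m r c)) = m r c * f (Matrix.single r c 1) := by
    intro r c
    rw [← smul_eq_mul, ← map_smul, Matrix.smul_single, smul_eq_mul, mul_one]
  conv_lhs => rw [Matrix.matrix_eq_sum_single m]
  simp_rw [map_sum, h2, h1, mul_ite, mul_zero, Finset.sum_ite_eq, Finset.mem_univ, if_true]
  rw [← Finset.sum_mul, mul_comm]; rfl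

theorem exists_isTraceExpansion (τ : A →ₗ[ℂ] ℂ) (hτ : ∀ a b, τ (a * b) = τ (b * a)) :
    ∃ t, D.IsTraceExpansion τ t := by
  refine ⟨fun i => τ (D.ofBlock i (Matrix.single (D.zeroIdx i) (D.zeroIdx i) 1)), fun a => ?_⟩
  conv_lhs => rw [← D.sum_ofBlock_rep a]
  rw [map_sum]
  refine Finset.sum_congr rfl fun i _ => ?_
  exact Matrix.eq_smul_trace_of_mul_comm (τ ∘ₗ D.ofBlock i)
    (fun m n => by simp only [LinearMap.comp_apply, ofBlock_mul, hτ]) (D.zeroIdx i) (D.rep i a)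

theorem existsUnique_isTraceExpansion (τ : A →ₗ[ℂ] ℂ) (hτ : ∀ a b, τ (a * b) = τ (b * a)) :
    ∃! t, D.IsTraceExpansion τ t :=
  (D.exists_isTraceExpansion τ hτ).elim fun t ht => ⟨t, ht, fun _ h => h.unique ht⟩

/-- An algebra homomorphism to `ℂ` is the character of a block of dimension one. -/
theorem exists_character_eq (φ : A →ₐ[ℂ] ℂ) :
    ∃ i, D.dim i = 1 ∧ ∀ a, D.character i a = φ a := by
  obtain ⟨t, ht⟩ := D.exists_isTraceExpansion φ.toLinearMap fun a b => by simp [mul_comm]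
  have ht1 (i) : φ (D.ofBlock i (Matrix.single (D.zeroIdx i) (D.zeroIdx i) 1)) = t i :=
    ht.apply_single i
  have htd (i) : φ (D.ofBlock i 1) = t i * D.dim i := by
    simpa using ht.apply_ofBlock i 1
  have h0 : ∃ i, t i ≠ 0 := by
    by_contra! h
    have := ht 1
    simp [h] at this
  obtain ⟨i, hi⟩ := h0
  -- Idempotents have value 0 or 1 under `φ`. The rank-one idempotent forces `t i = 1`, the block
  -- identity then forces dimension 1, and orthogonality to this block kills all other coefficients.
  have hi1 : t i = 1 := by
    have : t i * t i = t i := by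
      rw [← ht1, ← map_mul, ← ofBlock_mul, Matrix.single_mul_single_same, one_mul]
    exact (mul_eq_left₀ hi).1 this
  have hd : D.dim i = 1 := by
    have h : (D.dim i : ℂ) * D.dim i = D.dim i := by
      have := htd i
      rw [hi1, one_mul] at this
      rw [← this, ← map_mul, ← ofBlock_mul, one_mul]
    have hne : (D.dim i : ℂ) ≠ 0 := Nat.cast_ne_zero.2 (D.dim_pos i).ne'
    exact_mod_cast (mul_eq_left₀ hne).1 h
  refine ⟨i, hd, fun a => ?_⟩
  have h := ht a
  rw [Finset.sum_eq_single i, hi1, one_mul] at h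
  · exact h.symm
  · intro j _ hj
    have : t j * t i = 0 := by
      rw [← ht1, ← ht1, ← map_mul, D.ofBlock_mul_ofBlock_of_ne hj, map_zero]
    rw [hi1, mul_one] at this
    rw [this, zero_mul]
  · simp

/-- The trace of left multiplication is the sum of the characters with their dimensions. -/
theorem trace_mulLeft (a : A) :
    LinearMap.trace ℂ A (LinearMap.mulLeft ℂ a) = ∑ i, (D.dim i : ℂ) * D.character i a := by
  classical
  let b := (Pi.basis fun i : D.Index =>
    Matrix.stdBasis ℂ (Fin (D.dim i)) (Fin (D.dim i))).map D.equiv.symm.toLinearEquiv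
  rw [LinearMap.trace_eq_matrix_trace ℂ b, Matrix.trace, Fintype.sum_sigma]
  refine Finset.sum_congr rfl fun i _ => ?_
  -- The diagonal coefficient at `E_rc` does not depend on `c`, so summing over columns produces the
  -- factor `D.dim i`.
  have h (r c : Fin (D.dim i)) :
      (LinearMap.toMatrix b b (LinearMap.mulLeft ℂ a)).diag ⟨i, r, c⟩ = D.rep i a r r := by
    rw [Matrix.diag_apply, LinearMap.toMatrix_apply]
    simp [b, rep_apply, Matrix.stdBasis, Pi.basis_repr, ← Matrix.single_eq_of_single_single]
  rw [Fintype.sum_prod_type]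
  simp only [h, Finset.sum_const, Finset.card_univ, Fintype.card_fin, nsmul_eq_mul]
  rw [← Finset.mul_sum]; rfl

theorem nonempty_of_isSemisimpleRing [FiniteDimensional ℂ A] [IsSemisimpleRing A] :
    Nonempty (MatrixDecomposition A) := by
  obtain ⟨n, d, hd, ⟨e⟩⟩ := IsSemisimpleRing.exists_algEquiv_pi_matrix_of_isAlgClosed ℂ A
  exact ⟨⟨Fin n, d, fun i => Nat.pos_of_ne_zero (hd i).out, e⟩⟩

end MatrixDecomposition

/-! ### Reversible chains and return probabilities. -/

namespace MarkovChain

variable {X : Type*} [Fintype X] [DecidableEq X]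

theorem IsReversible.pow {π : X → ℝ} {K : Matrix X X ℝ} (h : IsReversible π K) (n : ℕ) :
    IsReversible π (K ^ n) := by
  induction n with
  | zero =>
    intro x y
    by_cases hxy : x = y
    · rw [hxy]
    · simp [Matrix.one_apply_ne hxy, Matrix.one_apply_ne (Ne.symm hxy)]
  | succ n ih =>
    intro x y
    -- The two sides are split oppositely, as `K^n * K` and `K * K^n`, so that paths are matched
    -- with their reversals.
    rw [pow_succ, Matrix.mul_apply, ← pow_succ, pow_succ', Matrix.mul_apply, Finset.mul_sum,
      Finset.mul_sum]
    refine Finset.sum_congr rfl fun z _ => ?_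
    rw [← mul_assoc, ih x z, mul_right_comm, h z y]
    ring

/-- For a reversible chain, the squared `L²(π)` distance to stationarity after `n` steps is given
by the return probability after `2n` steps. -/
theorem sqDist_eq {π : X → ℝ} (hpos : ∀ x, 0 < π x) (hsum : ∑ x, π x = 1) {K : Matrix X X ℝ}
    (hK : K ∈ Matrix.rowStochastic ℝ X) (hrev : IsReversible π K) (n : ℕ) (x : X) :
    sqDist π K n x = (K ^ (2 * n)) x x / π x - 1 := by
  have hrow := Matrix.sum_row_of_mem_rowStochastic (pow_mem hK n) x
  -- Detailed balance turns the quadratic term `K^n(x,y)²/π(y)` into a summand of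
  -- `K^{2n}(x,x)/π(x)`.
  have hterm (y : X) : ((K ^ n) x y / π y - 1) * ((K ^ n) x y / π y - 1) * π y =
      (K ^ n) x y * (K ^ n) y x / π x - 2 * (K ^ n) x y + π y := by
    have h := hrev.pow n x y
    have hx := (hpos x).ne'
    have hy := (hpos y).ne'
    have h' : (K ^ n) y x = π x * (K ^ n) x y / π y := by
      rw [eq_div_iff hy, h, mul_comm]
    rw [h']
    field_simp
    ring
  rw [sqDist, innerL2]
  simp only [hterm, Finset.sum_add_distrib, Finset.sum_sub_distrib, ← Finset.mul_sum,
    ← Finset.sum_div, hrow, hsum]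
  rw [← Matrix.mul_apply, ← pow_add, ← two_mul]
  ring

end MarkovChain

/-! ### Chains given by left multiplication. -/

namespace CoxeterSystem

variable {B W : Type*} [Group W] [Fintype W] {M : CoxeterMatrix B} {cs : CoxeterSystem M W} {q : ℝ}

theorem poincare_pos (cs : CoxeterSystem M W) (hq : 0 < q) : 0 < cs.poincare q :=
  Finset.sum_pos (fun _ _ => pow_pos hq _) Finset.univ_nonempty

theorem lengthDistribution_pos (cs : CoxeterSystem M W) {θ : ℝ} (hθ : 0 < θ) (w : W) :
    0 < cs.lengthDistribution θ w :=
  div_pos (pow_pos (inv_pos.2 hθ) _) (cs.poincare_pos (inv_pos.2 hθ))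

theorem sum_lengthDistribution (cs : CoxeterSystem M W) {θ : ℝ} (hθ : 0 < θ) :
    ∑ w, cs.lengthDistribution θ w = 1 := by
  simp only [lengthDistribution, ← Finset.sum_div]
  exact div_self (cs.poincare_pos (inv_pos.2 hθ)).ne'

section IsLeftMulMatrix

variable {k : cs.HeckeAlgebra q} {K : Matrix W W ℝ}

theorem IsLeftMulMatrix.pow [DecidableEq W] (h : cs.IsLeftMulMatrix k K) (n : ℕ) :
    cs.IsLeftMulMatrix (k ^ n) (K ^ n) := by
  induction n with
  | zero => intro x; simp [Matrix.one_apply]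
  | succ n ih =>
    intro x
    -- Coefficients are stored in rows, which reverses products: `k^n * k` corresponds to `K * K^n`.
    rw [pow_succ, mul_assoc, h x, Finset.mul_sum, pow_succ']
    simp only [mul_smul_comm, ih _, Matrix.mul_apply, Finset.smul_sum, smul_smul]
    rw [Finset.sum_comm]
    refine Finset.sum_congr rfl fun y _ => ?_
    rw [← Finset.sum_smul]
    push_cast
    rfl

/-- Rescaling the basis vectors does not change diagonal coefficients. -/
theorem IsLeftMulMatrix.repr_mul_heckeT (hq : 0 < q) (h : cs.IsLeftMulMatrix k K) (x : W) :
    (cs.heckeBasis q).repr (k * cs.heckeT q x) x = K x x := by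
  classical
  have hx : (q : ℂ) ^ cs.length x ≠ 0 := pow_ne_zero _ (Complex.ofReal_ne_zero.2 hq.ne')
  have e := congrArg (fun f => (cs.heckeBasis q).repr f x) (h x)
  simp only [heckeTNormalized, mul_smul_comm, map_smul, map_sum, Finsupp.smul_apply,
    Finsupp.finsetSum_apply, smul_eq_mul] at e
  rw [Finset.sum_eq_single x] at e
  · simp only [heckeT, Module.Basis.repr_self, Finsupp.single_eq_same] at e ⊢
    field_simp at e
    exact e
  · intro y _ hy; simp [heckeT, hy]
  · simp

/-- Every normalized basis element has index 1, so the index of `k` is a row sum of `K`. -/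
theorem IsLeftMulMatrix.heckeIndex_eq_one [DecidableEq W] (hq : 0 < q)
    (h : cs.IsLeftMulMatrix k K) (hK : K ∈ Matrix.rowStochastic ℝ W) : cs.heckeIndex q k = 1 := by
  have hn (x : W) : cs.heckeIndex q (cs.heckeTNormalized q x) = 1 := by
    rw [heckeTNormalized, map_smul, heckeIndex_heckeT, smul_eq_mul,
      inv_mul_cancel₀ (pow_ne_zero _ (Complex.ofReal_ne_zero.2 hq.ne'))]
  have e := congrArg (cs.heckeIndex q) (h 1)
  simp only [map_mul, map_sum, map_smul, hn, smul_eq_mul, mul_one] at e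
  rw [e]
  exact_mod_cast Matrix.sum_row_of_mem_rowStochastic hK 1

theorem IsLeftMulMatrix.trace_mulLeft [DecidableEq W] (hq : 0 < q) (h : cs.IsLeftMulMatrix k K) :
    LinearMap.trace ℂ _ (LinearMap.mulLeft ℂ k) = ∑ x, (K x x : ℂ) := by
  rw [LinearMap.trace_eq_matrix_trace ℂ (cs.heckeBasis q), Matrix.trace]
  refine Finset.sum_congr rfl fun x _ => ?_
  rw [Matrix.diag_apply, LinearMap.toMatrix_apply]
  exact h.repr_mul_heckeT hq x

theorem IsLeftMulMatrix.heckeTrace_conj (hq : 0 < q) (h : cs.IsLeftMulMatrix k K) (x : W) :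
    cs.heckeTrace q (cs.heckeT q x⁻¹ * k * cs.heckeT q x) =
      cs.poincare q * ((q : ℂ) ^ cs.length x * K x x) := by
  rw [mul_assoc, heckeTrace_heckeT_mul, h.repr_mul_heckeT hq]

end IsLeftMulMatrix

end CoxeterSystem

/-! ### The trivial block and its generic degree. -/

namespace MatrixDecomposition

open CoxeterSystem

variable {B W : Type*} [Group W] {M : CoxeterMatrix B} {cs : CoxeterSystem M W} {q : ℝ}
  {D : MatrixDecomposition (cs.HeckeAlgebra q)}

theorem IsTrivialIndex.character_eq {i : D.Index} (h : D.IsTrivialIndex i)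
    (a : cs.HeckeAlgebra q) : D.character i a = cs.heckeIndex q a := by
  have key : D.characterₗ i = (cs.heckeIndex q).toLinearMap :=
    (cs.heckeBasis q).ext fun w => (h.2 w).trans (cs.heckeIndex_heckeT q w).symm
  exact LinearMap.congr_fun key a

variable (D) in
theorem existsUnique_isTrivialIndex : ∃! i, D.IsTrivialIndex i := by
  obtain ⟨i, hd, hi⟩ := D.exists_character_eq (cs.heckeIndex q)
  refine ⟨i, ⟨hd, fun w => by rw [hi, heckeIndex_heckeT]⟩, fun j hj => ?_⟩
  exact D.character_injective fun a => by rw [hj.character_eq, hi]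

/-- The coefficient of the trivial character in the trace is `1`. -/
theorem IsTrivialIndex.coeff_eq_one [Fintype W] (hq : 0 < q) {i : D.Index}
    (h : D.IsTrivialIndex i) {t : D.Index → ℂ} (ht : D.IsTraceExpansion (cs.heckeTrace q) t) :
    t i = 1 := by
  have hP : (cs.poincare q : ℂ) ≠ 0 := Complex.ofReal_ne_zero.2 (cs.poincare_pos hq).ne'
  -- The identity of the trivial block has index 1, so it fixes `∑ T_w`, and every other character
  -- vanishes on that sum. Trace and index both take the value `P_W(q)` there, which forces the
  -- coefficient 1.
  have he : D.ofBlock i 1 * ∑ w, cs.heckeT q w = ∑ w, cs.heckeT q w := by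
    rw [cs.mul_sum_heckeT q hq, ← h.character_eq, D.character_ofBlock_same, Matrix.trace_one,
      Fintype.card_fin, h.1, Nat.cast_one, one_smul]
  have := ht (∑ w, cs.heckeT q w)
  rw [heckeTrace_sum_heckeT, Finset.sum_eq_single i, h.character_eq, heckeIndex_sum_heckeT] at this
  · exact (mul_eq_right₀ hP).1 this.symm
  · intro j _ hj
    rw [← he, character, map_mul, D.rep_ofBlock_of_ne hj, zero_mul, Matrix.trace_zero, mul_zero]
  · simp

end MatrixDecomposition

/-! ### Assembly of the two formulas. -/

theorem proposition4p8 {B W : Type*} [Group W] [Fintype W] [DecidableEq W] {M : CoxeterMatrix B}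
    (cs : CoxeterSystem M W) (θ : ℝ) (hθ0 : 0 < θ) (hθ1 : θ ≤ 1) (q : ℝ) (hq : q = θ⁻¹)
    (K : Matrix W W ℝ) (hK : K ∈ Matrix.rowStochastic ℝ W)
    (hrev : MarkovChain.IsReversible (cs.lengthDistribution θ) K)
    (k : cs.HeckeAlgebra q) (hk : cs.IsLeftMulMatrix k K) :
    Nonempty (MatrixDecomposition (cs.HeckeAlgebra q)) ∧
    ∀ D : MatrixDecomposition (cs.HeckeAlgebra q),
      (∃! i, D.IsTrivialIndex i) ∧ (∃! t, D.IsTraceExpansion (cs.heckeTrace q) t) ∧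
      ∀ (i₁ : D.Index) (t : D.Index → ℂ), D.IsTrivialIndex i₁ →
        D.IsTraceExpansion (cs.heckeTrace q) t → ∀ n : ℕ,
          (∀ x : W,
            (MarkovChain.sqDist (cs.lengthDistribution θ) K n x : ℂ) =
              ((q : ℂ) ^ (2 * cs.length x))⁻¹ *
                ∑ i with i ≠ i₁,
                  t i * D.character i (cs.heckeT q x⁻¹ * k ^ (2 * n) * cs.heckeT q x)) ∧
          ((∑ x, cs.lengthDistribution θ x *
              MarkovChain.sqDist (cs.lengthDistribution θ) K n x : ℝ) : ℂ) =
            ∑ i with i ≠ i₁, (D.dim i : ℂ) * D.character i (k ^ (2 * n)) := by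
  have hq0 : 0 < q := hq ▸ inv_pos.2 hθ0
  have hqC : (q : ℂ) ≠ 0 := Complex.ofReal_ne_zero.2 hq0.ne'
  have hP : (cs.poincare q : ℂ) ≠ 0 := Complex.ofReal_ne_zero.2 (cs.poincare_pos hq0).ne'
  have hpos := cs.lengthDistribution_pos hθ0
  have hsum := cs.sum_lengthDistribution hθ0
  have := cs.heckeAlgebra_isSemisimpleRing hq0
  refine ⟨MatrixDecomposition.nonempty_of_isSemisimpleRing, fun D =>
    ⟨D.existsUnique_isTrivialIndex,
      D.existsUnique_isTraceExpansion _ (cs.heckeTrace_mul_comm q), fun i₁ t hi ht n => ?_⟩⟩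
  have hk2 := hk.pow (2 * n)
  have hε : cs.heckeIndex q (k ^ (2 * n)) = 1 := by
    rw [map_pow, hk.heckeIndex_eq_one hq0 hK, one_pow]
  have hsplit (f : D.Index → ℂ) : ∑ i with i ≠ i₁, f i = ∑ i, f i - f i₁ := by
    rw [Finset.filter_ne', ← Finset.sum_erase_add _ _ (Finset.mem_univ i₁), add_sub_cancel_right]
  refine ⟨fun x => ?_, ?_⟩
  -- The trivial term is `q^ℓ(x) · 1 · q^ℓ(x)`, which the prefactor normalizes to 1; the full trace
  -- becomes `K^{2n}(x,x)/π(x)`.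
  · rw [hsplit, ← ht, hi.coeff_eq_one hq0 ht, hi.character_eq, map_mul (cs.heckeIndex q),
      map_mul (cs.heckeIndex q), hε, cs.heckeIndex_heckeT, cs.heckeIndex_heckeT, cs.length_inv, hk2.heckeTrace_conj hq0,
      MarkovChain.sqDist_eq hpos hsum hK hrev, CoxeterSystem.lengthDistribution, ← hq]
    push_cast
    field_simp
    ring
  -- The weight `π(x)` cancels the denominator, so the sum over `x` is the trace of `K^{2n}` minus
  -- the total mass 1.
  · have hterm (x : W) : cs.lengthDistribution θ x *
        MarkovChain.sqDist (cs.lengthDistribution θ) K n x =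
        (K ^ (2 * n)) x x - cs.lengthDistribution θ x := by
      rw [MarkovChain.sqDist_eq hpos hsum hK hrev, mul_sub, mul_one,
        mul_div_cancel₀ _ (hpos x).ne']
    rw [hsplit, ← D.trace_mulLeft, hk2.trace_mulLeft hq0, hi.character_eq, hε, hi.1]
    simp only [hterm, Finset.sum_sub_distrib, hsum]
    push_cast
    ring
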